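/- **Setting.** The Levi-Civita field $\mathcal R$ is the set of functions $f:\mathbb Q\to\mathbb R$ whose support is left-finite (for every $r\in\mathbb Q$ only finitely many points of the support are smaller than $r$), with pointwise addition and with multiplication $(f\cdot g)(q)=\sum_{q_1+q_2=q}f(q_1)g(q_2)$. It is an ordered field in which $f\neq 0$ is positive iff $f(\min\operatorname{supp} f)>0$; it carries its order topology. A real number $c$ is identified with the function that is $c$ at $0$ and $0$ elsewhere, and $\tau\in\mathcal R$ is the function that is $1$ at $1$ and $0$ elsewhere. For $m\in\mathbb Z$, $o(\tau^m)$ denotes an element of the form $\sum_{k\ge m+1}a_k\tau^k$ ($k\in\mathbb Z$, $a_k\in\mathbb R$). A network over an ordered field $K$ is a locally finite connected graph on a vertex set $V$ with symmetric weights $\rho_{xy}\in K$, positive on edges and $0$ on non-edges, a vertex $a_0$ and a non-empty set $B\subset V\setminus\{a_0\}$. If $V$ is finite, there is a unique $v:V\to K$ with $\sum_y (v(y)-v(x))\rho_{xy}=0$ for $x\notin B\cup\{a_0\}$, $v=0$ on $B$ and $v(a_0)=1$, and the effective admittance is $\mathcal P_{eff}=\sum_{x\sim a_0}(1-v(x))\rho_{xa_0}$.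 If $V$ is infinite, then (zero potential at infinity) the exhausting finite networks are $\Gamma_n=(V_n,\rho|_{V_n},a_0,(B\cap V_n)\cup\partial V_n)$, $n\ge 1$, where $V_n=\{x:\operatorname{dist}(a_0,x)\le n\}$, $\partial V_n=\{x:\operatorname{dist}(a_0,x)=n\}$ and $\operatorname{dist}$ is the graph distance. **Theorem.** Let $L,C>0$ be real, $\alpha=L^{-1}\tau$ and $\beta=C\tau^{-1}$ in $\mathcal R$. Let $\Gamma$ be Feynman's infinite $LC$ ladder network over $\mathcal R$: its vertices are $a_0,a_1,a_2,\dots,x_1,x_2,\dots$, its weights are $\rho_{a_0x_1}=\rho_{x_ix_{i+1}}=\alpha$ and $\rho_{a_ix_i}=\beta$ for $i\ge1$ (there are no other edges), and $B=\{a_1,a_2,\dots\}$. Let $(\Gamma_n)_{n\ge1}$ be the exhausting finite networks. Then $\frac{\beta}{\alpha}+\left(\frac{\beta}{2\alpha}\right)^2$ has exactly one positive square root $\xi$ in $\mathcal R$; put $\psi_1=1+\frac{\beta}{2\alpha}+\xi$. In the order topology of $\mathcal R$, $$\mathcal P_{eff}(\Gamma_n)\longrightarrow\frac{\beta}{\frac{\beta}{2\alpha}+\xi}\qquad(n\to\infty),$$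 and for every $n\ge1$ $$\mathcal P_{eff}(\Gamma_n)-\frac{\beta}{\frac{\beta}{2\alpha}+\xi}=\frac{2\alpha\xi}{\psi_1^{2n}-1}=\frac{C}{(CL)^{2n}}\,\tau^{4n-1}+o\left(\tau^{4n-1}\right).$$ -/

import Mathlib

open Filter Topology

/-! ### The Levi-Civita field -/

/-- A set of rationals is left-finite if below every rational it has only finitely many elements. -/
def LeftFinite (M : Set ℚ) : Prop :=
  ∀ r : ℚ, (M ∩ Set.Iio r).Finite

theorem LeftFinite.mono {M N : Set ℚ} (hN : LeftFinite N) (h : M ⊆ N) : LeftFinite M :=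
  fun r => (hN r).subset (Set.inter_subset_inter_left _ h)

theorem LeftFinite.of_finite {M : Set ℚ} (h : M.Finite) : LeftFinite M :=
  fun _ => h.inter_of_left _

theorem LeftFinite.union {M N : Set ℚ} (hM : LeftFinite M) (hN : LeftFinite N) :
    LeftFinite (M ∪ N) := by
  intro r
  rw [Set.union_inter_distrib_right]
  exact (hM r).union (hN r)

theorem LeftFinite.bddBelow {M : Set ℚ} (h : LeftFinite M) : ∃ m : ℚ, ∀ q ∈ M, m ≤ q := by
  obtain ⟨m, hm⟩ := (h 0).bddBelow
  refine ⟨min m 0, fun q hq => ?_⟩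
  by_cases h0 : q < 0
  · exact (min_le_left _ _).trans (hm ⟨hq, h0⟩)
  · exact (min_le_right _ _).trans (not_lt.mp h0)

open scoped Pointwise in
theorem LeftFinite.add {M N : Set ℚ} (hM : LeftFinite M) (hN : LeftFinite N) :
    LeftFinite (M + N) := by
  obtain ⟨m, hm⟩ := hM.bddBelow
  obtain ⟨n, hn⟩ := hN.bddBelow
  intro r
  refine ((hM (r - n)).add (hN (r - m))).subset ?_
  rintro _ ⟨⟨a, ha, b, hb, rfl⟩, hr⟩
  have h1 := hm a ha
  have h2 := hn b hb
  have h3 : a + b < r := hr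
  exact ⟨a, ⟨ha, by simp only [Set.mem_Iio]; linarith⟩, b,
    ⟨hb, by simp only [Set.mem_Iio]; linarith⟩, rfl⟩

theorem LeftFinite.mul_support {x y : HahnSeries ℚ ℝ} (hx : LeftFinite x.support)
    (hy : LeftFinite y.support) : LeftFinite (x * y).support :=
  (hx.add hy).mono HahnSeries.support_mul_subset

theorem LeftFinite.single_support (q : ℚ) (c : ℝ) :
    LeftFinite (HahnSeries.single q c).support :=
  LeftFinite.of_finite ((Set.finite_singleton q).subset HahnSeries.support_single_subset)

theorem LeftFinite.sub_support {x y : HahnSeries ℚ ℝ} (hx : LeftFinite x.support)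
    (hy : LeftFinite y.support) : LeftFinite (x - y).support := by
  refine (hx.union hy).mono fun q hq => ?_
  by_contra h
  simp only [Set.mem_union, HahnSeries.mem_support, not_or, not_not] at h
  simp [h.1, h.2] at hq

theorem LeftFinite.pow_support {x : HahnSeries ℚ ℝ} (hx : LeftFinite x.support) (k : ℕ) :
    LeftFinite (x ^ k).support := by
  induction k with
  | zero => rw [pow_zero]; exact LeftFinite.single_support 0 1
  | succ k ih => rw [pow_succ]; exact ih.mul_support hx

theorem LeftFinite.hsum_powers_support {y : HahnSeries ℚ ℝ} (hy : LeftFinite y.support) :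
    LeftFinite (HahnSeries.SummableFamily.powers y).hsum.support := by
  by_cases hpos : 0 < y.orderTop
  swap
  · rw [HahnSeries.SummableFamily.powers_of_not_orderTop_pos hpos]
    simpa using LeftFinite.single_support 0 1
  by_cases h0 : y = 0
  · subst h0
    simpa using LeftFinite.single_support 0 1
  have hord : 0 < y.order := by
    rw [← HahnSeries.order_eq_orderTop_of_ne_zero h0] at hpos
    exact_mod_cast hpos
  intro r
  obtain ⟨N, hN⟩ := exists_nat_gt (r / y.order)
  refine ((Set.finite_Iio N).biUnion fun k _ => hy.pow_support k r).subset ?_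
  rintro q ⟨hq, hqr⟩
  have hqr' : q < r := hqr
  rw [HahnSeries.mem_support, HahnSeries.SummableFamily.coeff_hsum] at hq
  obtain ⟨k, hk⟩ : ∃ k, ((HahnSeries.SummableFamily.powers y) k).coeff q ≠ 0 := by
    by_contra hcon
    push Not at hcon
    exact hq (by rw [finsum_congr hcon, finsum_zero])
  rw [HahnSeries.SummableFamily.powers_of_orderTop_pos hpos] at hk
  have hle := HahnSeries.order_le_of_coeff_ne_zero hk
  rw [HahnSeries.order_pow, nsmul_eq_mul] at hle
  have hkN : (k : ℚ) < N := by
    refine lt_trans ?_ hN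
    rw [lt_div_iff₀ hord]
    linarith
  exact Set.mem_biUnion (Set.mem_Iio.mpr (by exact_mod_cast hkN)) ⟨hk, hqr⟩

theorem LeftFinite.inv_support {x : HahnSeries ℚ ℝ} (hx : LeftFinite x.support) :
    LeftFinite (x⁻¹).support := by
  rw [HahnSeries.inv_def]
  refine (LeftFinite.single_support _ _).mul_support (LeftFinite.hsum_powers_support ?_)
  exact LeftFinite.sub_support (LeftFinite.single_support 0 1)
    ((LeftFinite.single_support _ _).mul_support hx)

/-- The functions `ℚ → ℝ` with left-finite support, as a subfield of the Hahn series field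
`ℝ⟦ℚ⟧` with its lexicographic order (a left-finite set is well-ordered, so every such function
is the coefficient function of a Hahn series).  Addition is pointwise, multiplication is
convolution, and an element is positive iff its coefficient at the least point of its support
is positive. -/
noncomputable def leviCivitaSubfield : Subfield (Lex (HahnSeries ℚ ℝ)) where
  carrier := {x | LeftFinite (ofLex x).support}
  mul_mem' hx hy := LeftFinite.mul_support hx hy
  one_mem' := LeftFinite.single_support 0 1
  add_mem' hx hy := (LeftFinite.union hx hy).mono (HahnSeries.support_add_subset _ _)
  zero_mem' := LeftFinite.of_finite (by simp)
  neg_mem' {x} hx := by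
    have h : (ofLex (-x)).support = (ofLex x).support := by
      rw [ofLex_neg, HahnSeries.support_neg]
    simpa only [Set.mem_ofPred_eq, h] using hx
  inv_mem' _ hx := LeftFinite.inv_support hx

/-- The Levi-Civita field, an ordered field. -/
abbrev LeviCivita : Type := leviCivitaSubfield

namespace LeviCivita

/-- The order topology of the Levi-Civita field. -/
instance : TopologicalSpace LeviCivita := Preorder.topology LeviCivita

instance : OrderTopology LeviCivita := ⟨rfl⟩

/-- The function `ℚ → ℝ` underlying an element of the Levi-Civita field. -/
def coeff (x : LeviCivita) (q : ℚ) : ℝ := (ofLex (x : Lex (HahnSeries ℚ ℝ))).coeff q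

/-- The function with value `c` at `q` and `0` elsewhere. -/
noncomputable def monomial (q : ℚ) (c : ℝ) : LeviCivita :=
  ⟨toLex (HahnSeries.single q c), LeftFinite.single_support q c⟩

/-- The real number `c` as an element of the Levi-Civita field. -/
noncomputable def ofReal (c : ℝ) : LeviCivita := monomial 0 c

/-- The infinitesimal `τ`: the function with value `1` at `1` and `0` elsewhere. -/
noncomputable def τ : LeviCivita := monomial 1 1

/-- `x = o(τ ^ m)`, meaning that `x` is a series `∑ aₖ τ ^ k` over the integers `k ≥ m + 1`. -/
def IsLittleOTau (x : LeviCivita) (m : ℤ) : Prop :=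
  ∀ q : ℚ, x.coeff q ≠ 0 → ∃ k : ℤ, m + 1 ≤ k ∧ q = k

theorem monomial_pos {q : ℚ} {c : ℝ} (hc : 0 < c) : 0 < monomial q c := by
  change (0 : Lex (HahnSeries ℚ ℝ)) < toLex (HahnSeries.single q c)
  rw [← HahnSeries.leadingCoeff_pos_iff]
  simpa using hc

theorem ofReal_pos {c : ℝ} (hc : 0 < c) : 0 < ofReal c := monomial_pos hc

theorem τ_pos : 0 < τ := monomial_pos one_pos

end LeviCivita

/-! ### Networks over an ordered field -/

/-- A network over the ordered field `K`: a locally finite connected graph on `V` with positive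
edge weights (admittances), extended by `0` to the pairs that are not edges, a vertex `a₀` and a
nonempty set `B` of further vertices.  (`V` then has at least two elements.) -/
structure Network (K : Type*) [Field K] [LinearOrder K] (V : Type*) where
  graph : SimpleGraph V
  connected : graph.Connected
  locallyFinite : ∀ x, (graph.neighborSet x).Finite
  ρ : V → V → K
  ρ_symm : ∀ x y, ρ x y = ρ y x
  ρ_pos : ∀ x y, graph.Adj x y → 0 < ρ x y
  ρ_eq_zero : ∀ x y, ¬ graph.Adj x y → ρ x y = 0
  a₀ : V
  B : Set V
  B_nonempty : B.Nonempty
  a₀_notMem_B : a₀ ∉ B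

namespace Network

variable {K : Type*} [Field K] [LinearOrder K] {V : Type*}

/-- The boundary `B₀ = B ∪ {a₀}`. -/
def boundary (Γ : Network K V) : Set V := Γ.B ∪ {Γ.a₀}

/-- The Laplace operator `Δ_ρ v (x) = ∑_y (v(y) - v(x)) ρ_{xy}` (a finite sum, by local
finiteness). -/
noncomputable def laplacian (Γ : Network K V) (v : V → K) (x : V) : K :=
  ∑ᶠ y, (v y - v x) * Γ.ρ x y

/-- `v` solves the Dirichlet problem: it is harmonic off the boundary, `0` on `B` and `1` at
`a₀`. -/
def IsDirichletSolution (Γ : Network K V) (v : V → K) : Prop :=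
  (∀ x, x ∉ Γ.boundary → Γ.laplacian v x = 0) ∧ (∀ x ∈ Γ.B, v x = 0) ∧ v Γ.a₀ = 1

/-! #### The finite networks exhausting an infinite network -/

/-- `V_n`, the set of the vertices at distance at most `n` from `a₀`. -/
def ball (Γ : Network K V) (n : ℕ) : Set V := {x | Γ.graph.dist Γ.a₀ x ≤ n}

/-- `∂V_n`, the set of the vertices at distance exactly `n` from `a₀`. -/
def sphere (Γ : Network K V) (n : ℕ) : Set V := {x | Γ.graph.dist Γ.a₀ x = n}

theorem exists_pred (Γ : Network K V) {n : ℕ} {x : V} (hx : Γ.graph.dist Γ.a₀ x = n + 1) :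
    ∃ y, Γ.graph.Adj y x ∧ Γ.graph.dist Γ.a₀ y = n := by
  obtain ⟨p, hp⟩ := Γ.connected.exists_walk_length_eq_dist x Γ.a₀
  rw [SimpleGraph.dist_comm, hx] at hp
  cases p with
  | nil => simp at hp
  | @cons _ y _ h q =>
    rw [SimpleGraph.Walk.length_cons] at hp
    have h1 : Γ.graph.dist Γ.a₀ y ≤ n := by
      rw [SimpleGraph.dist_comm]
      exact (SimpleGraph.dist_le q).trans (by omega)
    rcases h.symm.diff_dist_adj (u := Γ.a₀) with h2 | h2 | h2 <;>
      exact ⟨y, h.symm, by omega⟩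

theorem ball_finite (Γ : Network K V) (n : ℕ) : (Γ.ball n).Finite := by
  induction n with
  | zero =>
    refine (Set.finite_singleton Γ.a₀).subset fun x hx => ?_
    have h0 : Γ.graph.dist Γ.a₀ x = 0 := Nat.le_zero.mp hx
    exact (Γ.connected.dist_eq_zero_iff.mp h0).symm
  | succ n ih =>
    refine (ih.union (ih.biUnion fun y _ => Γ.locallyFinite y)).subset fun x hx => ?_
    rcases Nat.lt_or_ge n (Γ.graph.dist Γ.a₀ x) with h | h
    · have hx' : Γ.graph.dist Γ.a₀ x ≤ n + 1 := hx
      obtain ⟨y, hy, hd⟩ := Γ.exists_pred (n := n) (x := x) (by omega)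
      exact Or.inr (Set.mem_biUnion (show y ∈ Γ.ball n from hd.le) hy)
    · exact Or.inl h

instance (Γ : Network K V) (n : ℕ) : Finite (Γ.ball n) := (Γ.ball_finite n).to_subtype

theorem a₀_mem_ball (Γ : Network K V) (n : ℕ) : Γ.a₀ ∈ Γ.ball n := by
  simp [ball]

theorem sphere_nonempty [Infinite V] (Γ : Network K V) (n : ℕ) : (Γ.sphere n).Nonempty := by
  obtain ⟨x, hx⟩ := (Γ.ball_finite n).exists_notMem
  have key : ∀ k x, Γ.graph.dist Γ.a₀ x = n + k → (Γ.sphere n).Nonempty := by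
    intro k
    induction k with
    | zero => exact fun x hx => ⟨x, hx⟩
    | succ k ih =>
      intro x hx
      obtain ⟨y, _, hy⟩ := Γ.exists_pred (n := n + k) (x := x) (by omega)
      exact ih y hy
  have hx' : n < Γ.graph.dist Γ.a₀ x := not_le.mp hx
  exact key (Γ.graph.dist Γ.a₀ x - n) x (by omega)

theorem ball_connected (Γ : Network K V) (n : ℕ) : (Γ.graph.induce (Γ.ball n)).Connected := by
  rw [SimpleGraph.connected_iff_exists_forall_reachable]
  refine ⟨⟨Γ.a₀, Γ.a₀_mem_ball n⟩, ?_⟩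
  have key : ∀ k x, Γ.graph.dist Γ.a₀ x = k → ∀ hx : x ∈ Γ.ball n,
      (Γ.graph.induce (Γ.ball n)).Reachable ⟨Γ.a₀, Γ.a₀_mem_ball n⟩ ⟨x, hx⟩ := by
    intro k
    induction k with
    | zero =>
      intro x h0 hx
      obtain rfl := Γ.connected.dist_eq_zero_iff.mp h0
      exact SimpleGraph.Reachable.refl _
    | succ k ih =>
      intro x hk hx
      obtain ⟨y, hyx, hy⟩ := Γ.exists_pred hk
      have hx' : Γ.graph.dist Γ.a₀ x ≤ n := hx
      have hyb : y ∈ Γ.ball n := show Γ.graph.dist Γ.a₀ y ≤ n by omega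
      have hadj : (Γ.graph.induce (Γ.ball n)).Adj ⟨y, hyb⟩ ⟨x, hx⟩ := hyx
      exact (ih y hy hyb).trans hadj.reachable
  exact fun x => key _ x rfl x.2

/-- The finite network `Γ_n = (V_n, ρ|_{V_n}, a₀, (B ∩ V_n) ∪ ∂V_n)`, `n ≥ 1`. -/
def exhaustion [Infinite V] (Γ : Network K V) (n : ℕ+) : Network K (Γ.ball n) where
  graph := Γ.graph.induce (Γ.ball n)
  connected := Γ.ball_connected n
  locallyFinite _ := Set.toFinite _
  ρ x y := Γ.ρ x y
  ρ_symm x y := Γ.ρ_symm x y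
  ρ_pos x y h := Γ.ρ_pos x y h
  ρ_eq_zero x y h := Γ.ρ_eq_zero x y h
  a₀ := ⟨Γ.a₀, Γ.a₀_mem_ball n⟩
  B := {x | (x : V) ∈ Γ.B ∪ Γ.sphere n}
  B_nonempty := by
    obtain ⟨x, hx⟩ := Γ.sphere_nonempty n
    exact ⟨⟨x, le_of_eq hx⟩, Or.inr hx⟩
  a₀_notMem_B := by
    rintro (h | h)
    · exact Γ.a₀_notMem_B h
    · have h' : Γ.graph.dist Γ.a₀ Γ.a₀ = n := h
      rw [SimpleGraph.dist_self] at h'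
      exact n.ne_zero h'.symm

/-! #### The Dirichlet problem on a finite network -/

variable [IsStrictOrderedRing K]

theorem harmonic_le_zero [Finite V] (Γ : Network K V) (v : V → K)
    (hv : ∀ x, x ∉ Γ.boundary → Γ.laplacian v x = 0) (hb : ∀ x ∈ Γ.boundary, v x = 0) (x : V) :
    v x ≤ 0 := by
  have := Fintype.ofFinite V
  have : Nonempty V := ⟨x⟩
  obtain ⟨m, hm⟩ := Finite.exists_max v
  suffices h : v m ≤ 0 from (hm x).trans h
  by_contra hpos
  push Not at hpos
  have step : ∀ y z, Γ.graph.Adj y z → v y = v m → v z = v m := by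
    intro y z hyz hy
    have hyb : y ∉ Γ.boundary := fun h => by rw [← hy, hb y h] at hpos; exact lt_irrefl _ hpos
    have h0 := hv y hyb
    rw [laplacian, finsum_eq_sum_of_fintype, Finset.sum_eq_zero_iff_of_nonpos] at h0
    · have h1 := h0 z (Finset.mem_univ z)
      rcases mul_eq_zero.mp h1 with h2 | h2
      · rw [sub_eq_zero.mp h2, hy]
      · exact absurd h2 (Γ.ρ_pos y z hyz).ne'
    · intro w _
      refine mul_nonpos_of_nonpos_of_nonneg (by rw [hy]; exact sub_nonpos.mpr (hm w)) ?_
      by_cases hw : Γ.graph.Adj y w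
      · exact (Γ.ρ_pos y w hw).le
      · rw [Γ.ρ_eq_zero y w hw]
  have walk : ∀ y z, Γ.graph.Walk y z → v y = v m → v z = v m := by
    intro y z p
    induction p with
    | nil => exact id
    | cons h _ ih => exact fun hy => ih (step _ _ h hy)
  obtain ⟨p⟩ := Γ.connected.preconnected m Γ.a₀
  have := walk _ _ p rfl
  rw [hb Γ.a₀ (Or.inr rfl)] at this
  exact hpos.ne this

/-- On a finite network the Dirichlet problem has exactly one solution. -/
theorem existsUnique_dirichletSolution [Finite V] (Γ : Network K V) :
    ∃! v : V → K, Γ.IsDirichletSolution v := by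
  classical
  have := Fintype.ofFinite V
  let T : (V → K) →ₗ[K] (V → K) :=
    { toFun := fun v x => if x ∈ Γ.boundary then v x else Γ.laplacian v x
      map_add' := by
        intro v w
        funext x
        by_cases hx : x ∈ Γ.boundary
        · simp [hx]
        · simp only [hx, if_false, Pi.add_apply, laplacian, finsum_eq_sum_of_fintype]
          rw [← Finset.sum_add_distrib]
          exact Finset.sum_congr rfl fun y _ => by ring
      map_smul' := by
        intro c v
        funext x
        by_cases hx : x ∈ Γ.boundary
        · simp [hx]
        · simp only [hx, if_false, Pi.smul_apply, laplacian, finsum_eq_sum_of_fintype,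
            smul_eq_mul, RingHom.id_apply]
          rw [Finset.mul_sum]
          exact Finset.sum_congr rfl fun y _ => by ring }
  have hT : ∀ v x, T v x = if x ∈ Γ.boundary then v x else Γ.laplacian v x := fun _ _ => rfl
  have hker : ∀ v, T v = 0 → ∀ x, v x ≤ 0 := by
    intro v hv
    refine Γ.harmonic_le_zero v (fun x hx => ?_) fun x hx => ?_
    · have := congrFun hv x
      rwa [hT, if_neg hx] at this
    · have := congrFun hv x
      rwa [hT, if_pos hx] at this
  have hinj : Function.Injective T := by
    rw [injective_iff_map_eq_zero]
    intro v hv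
    funext x
    refine le_antisymm (hker v hv x) ?_
    have := hker (-v) (by rw [map_neg, hv, neg_zero]) x
    simpa using this
  have hiff : ∀ v, Γ.IsDirichletSolution v ↔ T v = Pi.single Γ.a₀ 1 := by
    intro v
    constructor
    · rintro ⟨h1, h2, h3⟩
      funext x
      rw [hT]
      by_cases hx : x ∈ Γ.boundary
      · rw [if_pos hx]
        rcases hx with hx | hx
        · rw [h2 x hx, Pi.single_eq_of_ne]
          rintro rfl
          exact Γ.a₀_notMem_B hx
        · rw [Set.mem_singleton_iff.mp hx, h3, Pi.single_eq_same]
      · rw [if_neg hx, h1 x hx, Pi.single_eq_of_ne]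
        rintro rfl
        exact hx (Or.inr rfl)
    · intro h
      have h' : ∀ x, (if x ∈ Γ.boundary then v x else Γ.laplacian v x) =
          (Pi.single Γ.a₀ 1 : V → K) x := fun x => by rw [← hT, h]
      refine ⟨fun x hx => ?_, fun x hx => ?_, ?_⟩
      · have := h' x
        rwa [if_neg hx, Pi.single_eq_of_ne] at this
        rintro rfl
        exact hx (Or.inr rfl)
      · have := h' x
        rwa [if_pos (show x ∈ Γ.boundary from Or.inl hx), Pi.single_eq_of_ne] at this
        rintro rfl
        exact Γ.a₀_notMem_B hx
      · have := h' Γ.a₀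
        rwa [if_pos (show Γ.a₀ ∈ Γ.boundary from Or.inr rfl), Pi.single_eq_same] at this
  obtain ⟨v, hv⟩ := LinearMap.injective_iff_surjective.mp hinj (Pi.single Γ.a₀ 1)
  exact ⟨v, (hiff v).mpr hv, fun w hw => hinj (((hiff w).mp hw).trans hv.symm)⟩

/-- The solution of the Dirichlet problem on a finite network. -/
noncomputable def potential [Finite V] (Γ : Network K V) : V → K :=
  Γ.existsUnique_dirichletSolution.choose

/-- The effective admittance of a finite network, `∑_{x ∼ a₀} (1 - v(x)) ρ_{x a₀}` with `v` the
solution of the Dirichlet problem. -/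
noncomputable def effectiveAdmittance [Finite V] (Γ : Network K V) : K :=
  ∑ᶠ x, (1 - Γ.potential x) * Γ.ρ x Γ.a₀

end Network

/-! ### The ladder network -/

/-- The vertices `a₀, a₁, a₂, …` and `x₁, x₂, …` of the ladder; `a i` is `a_i` and `x i` is
`x_{i+1}`. -/
inductive LadderVertex : Type
  | a (i : ℕ)
  | x (i : ℕ)

namespace LadderVertex

instance : Infinite LadderVertex :=
  Infinite.of_injective LadderVertex.a fun _ _ h => LadderVertex.a.inj h

/-- The edges are `a₀x₁`, `x_i x_{i+1}` and `a_i x_i` for `i ≥ 1`. -/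
def Adj : LadderVertex → LadderVertex → Prop
  | a i, x j => (i = 0 ∧ j = 0) ∨ i = j + 1
  | x j, a i => (i = 0 ∧ j = 0) ∨ i = j + 1
  | x i, x j => j = i + 1 ∨ i = j + 1
  | a _, a _ => False

/-- The ladder graph. -/
def graph : SimpleGraph LadderVertex where
  Adj := Adj
  symm := by
    refine ⟨?_⟩
    rintro (i | i) (j | j) h
    · exact h
    · exact h
    · exact h
    · exact Or.symm h
  loopless := by
    refine ⟨?_⟩
    rintro (i | i) h
    · exact h
    · rcases h with h | h <;> omega

theorem graph_connected : graph.Connected := by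
  rw [SimpleGraph.connected_iff_exists_forall_reachable]
  refine ⟨a 0, ?_⟩
  have hx : ∀ i, graph.Reachable (a 0) (x i) := by
    intro i
    induction i with
    | zero =>
      have h : graph.Adj (a 0) (x 0) := Or.inl ⟨rfl, rfl⟩
      exact h.reachable
    | succ i ih =>
      have h : graph.Adj (x i) (x (i + 1)) := Or.inl rfl
      exact ih.trans h.reachable
  rintro (i | i)
  · rcases i with _ | i
    · exact SimpleGraph.Reachable.refl _
    · have h : graph.Adj (x i) (a (i + 1)) := Or.inr rfl
      exact (hx i).trans h.reachable
  · exact hx i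

theorem graph_locallyFinite (v : LadderVertex) : (graph.neighborSet v).Finite := by
  rcases v with i | i
  · refine (((Set.finite_Iic i).image x)).subset ?_
    rintro (j | j) h
    · exact h.elim
    · refine ⟨j, ?_, rfl⟩
      rcases h with h | h <;> simp only [Set.mem_Iic] <;> omega
  · refine (((Set.finite_Iic (i + 1)).image a).union ((Set.finite_Iic (i + 1)).image x)).subset ?_
    rintro (j | j) h
    · refine Or.inl ⟨j, ?_, rfl⟩
      rcases h with h | h <;> simp only [Set.mem_Iic] <;> omega
    · refine Or.inr ⟨j, ?_, rfl⟩
      rcases h with h | h <;> simp only [Set.mem_Iic] <;> omega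

/-- The admittances of the `αβ`-network: `ρ(a₀x₁) = ρ(x_i x_{i+1}) = α` and `ρ(a_i x_i) = β` for
`i ≥ 1`, and `0` for all other pairs. -/
def weight {K : Type*} [Zero K] (α β : K) : LadderVertex → LadderVertex → K
  | a i, x j => if i = 0 ∧ j = 0 then α else if i = j + 1 then β else 0
  | x j, a i => if i = 0 ∧ j = 0 then α else if i = j + 1 then β else 0
  | x i, x j => if j = i + 1 ∨ i = j + 1 then α else 0
  | a _, a _ => 0

end LadderVertex

/-- The infinite ladder (the `αβ`-network), with `B = {a₁, a₂, …}`. -/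
def ladderNetwork {K : Type*} [Field K] [LinearOrder K] (α β : K) (hα : 0 < α) (hβ : 0 < β) :
    Network K LadderVertex where
  graph := LadderVertex.graph
  connected := LadderVertex.graph_connected
  locallyFinite := LadderVertex.graph_locallyFinite
  ρ := LadderVertex.weight α β
  ρ_symm := by
    rintro (i | i) (j | j)
    · rfl
    · rfl
    · rfl
    · simp only [LadderVertex.weight, or_comm]
  ρ_pos := by
    rintro (i | i) (j | j) h
    · exact h.elim
    · have h' : (i = 0 ∧ j = 0) ∨ i = j + 1 := h
      simp only [LadderVertex.weight]
      split_ifs <;> first | assumption | (exfalso; tauto)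
    · have h' : (j = 0 ∧ i = 0) ∨ j = i + 1 := h
      simp only [LadderVertex.weight]
      split_ifs <;> first | assumption | (exfalso; tauto)
    · have h' : j = i + 1 ∨ i = j + 1 := h
      simp only [LadderVertex.weight, if_pos h']
      exact hα
  ρ_eq_zero := by
    rintro (i | i) (j | j) h
    · rfl
    · have h' : ¬ ((i = 0 ∧ j = 0) ∨ i = j + 1) := h
      simp only [LadderVertex.weight]
      rw [if_neg (fun h1 => h' (Or.inl h1)), if_neg (fun h1 => h' (Or.inr h1))]
    · have h' : ¬ ((j = 0 ∧ i = 0) ∨ j = i + 1) := h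
      simp only [LadderVertex.weight]
      rw [if_neg (fun h1 => h' (Or.inl h1)), if_neg (fun h1 => h' (Or.inr h1))]
    · have h' : ¬ (j = i + 1 ∨ i = j + 1) := h
      simp only [LadderVertex.weight, if_neg h']
  a₀ := LadderVertex.a 0
  B := {v | ∃ i : ℕ, v = LadderVertex.a (i + 1)}
  B_nonempty := ⟨LadderVertex.a 1, 0, rfl⟩
  a₀_notMem_B := by
    rintro ⟨i, hi⟩
    exact absurd (LadderVertex.a.inj hi) (by omega)

/-- Admittance `L⁻¹ τ` of a coil. -/
noncomputable def coilAdmittance (L : ℝ) : LeviCivita := LeviCivita.ofReal L⁻¹ * LeviCivita.τ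

/-- Admittance `C τ⁻¹` of a capacitor. -/
noncomputable def capacitorAdmittance (C : ℝ) : LeviCivita :=
  LeviCivita.ofReal C * LeviCivita.τ⁻¹

/-- Feynman's infinite `LC` ladder network: the `αβ`-network over the Levi-Civita field with
`α = L⁻¹ τ` and `β = C τ⁻¹`. -/
noncomputable def feynmanLadder (L C : ℝ) (hL : 0 < L) (hC : 0 < C) :
    Network LeviCivita LadderVertex :=
  ladderNetwork (coilAdmittance L) (capacitorAdmittance C)
    (mul_pos (LeviCivita.ofReal_pos (inv_pos.mpr hL)) LeviCivita.τ_pos)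
    (mul_pos (LeviCivita.ofReal_pos hC) (inv_pos.mpr LeviCivita.τ_pos))

/-!
Along the rail `a₀, x₁, x₂, …` the Dirichlet problem on `Γ_n` is the linear recurrence
`α (u_i - 2 u_{i+1} + u_{i+2}) = β u_{i+1}` with `u_0 = 1` and `u_n = 0`, and the admittance is
`α (1 - u_1)`. The characteristic roots are `1 + β/(2α) ± ξ`, mutually inverse, so that `u` is a
combination of `ψ^i` and `ψ^(-i)` with `ψ = 1 + β/(2α) + ξ`; this gives the exact value of
`P_eff(Γ_n)` over every ordered field.

In the Levi-Civita field, an element `c τ^m + o(τ^m)` is `τ^m` times a power series in `τ` with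
constant coefficient `c`. Such expansions can be multiplied, inverted and added, and by Hensel's
lemma for real power series one with even `m` and positive `c` has a square root of the same kind.
Whenever `α` and `β` have expansions with positive coefficients and `β/α` is infinitely large, so
is `ψ`; the expansion of the error `2αξ/(ψ^(2n) - 1)` therefore follows, and its exponent tends to
infinity with `n`, which is convergence in the order topology.
-/

theorem le_add_dist_of_adj_le {V : Type*} {G : SimpleGraph V} (hG : G.Connected) {h : V → ℕ}
    (hadj : ∀ v w, G.Adj v w → h w ≤ h v + 1) (v w : V) : h w ≤ h v + G.dist v w := by
  obtain ⟨p, hp⟩ := hG.exists_walk_length_eq_dist v w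
  rw [← hp]
  clear hp
  induction p with
  | nil => exact le_rfl
  | cons hvw _ ih =>
    rw [SimpleGraph.Walk.length_cons]
    have := hadj _ _ hvw
    omega

theorem dist_le_dist_add_one_of_adj {V : Type*} {G : SimpleGraph V} {u v w : V}
    (h : G.Adj v w) : G.dist u w ≤ G.dist u v + 1 := by
  rcases h.diff_dist_adj (u := u) with h | h | h <;> omega

namespace Network

variable {K : Type*} [Field K] [LinearOrder K] {V : Type*} (Γ : Network K V)

theorem laplacian_eq_sum (v : V → K) {x : V} {s : Finset V} (hs : ∀ y, Γ.graph.Adj x y → y ∈ s) :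
    Γ.laplacian v x = ∑ y ∈ s, (v y - v x) * Γ.ρ x y := by
  refine finsum_eq_sum_of_support_subset _ fun y hy => hs y ?_
  by_contra hxy
  exact hy (by simp only [Γ.ρ_eq_zero x y hxy, mul_zero])

theorem laplacian_exhaustion [Infinite V] (n : ℕ+) (v : V → K) {x : Γ.ball n}
    (hx : (x : V) ∉ Γ.sphere n) :
    (Γ.exhaustion n).laplacian (fun y => v y) x = Γ.laplacian v x := by
  have hlt : Γ.graph.dist Γ.a₀ x < n := lt_of_le_of_ne x.2 hx
  change ∑ᶠ y : Γ.ball n, (v y - v x) * Γ.ρ x y = ∑ᶠ y, (v y - v x) * Γ.ρ x y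
  rw [finsum_set_coe_eq_finsum_mem (f := fun y => (v y - v x) * Γ.ρ x y),
    ← finsum_mem_univ (fun y => (v y - v x) * Γ.ρ x y)]
  refine finsum_mem_inter_support_eq' _ _ _ fun y hy => ⟨fun _ => trivial, fun _ => ?_⟩
  have hadj : Γ.graph.Adj x y := by
    by_contra hxy
    exact hy (by simp only [Γ.ρ_eq_zero _ _ hxy, mul_zero])
  exact (dist_le_dist_add_one_of_adj hadj).trans hlt

variable {Γ} [IsStrictOrderedRing K]

theorem IsDirichletSolution.effectiveAdmittance_eq_neg_laplacian [Finite V] {v : V → K}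
    (hv : Γ.IsDirichletSolution v) : Γ.effectiveAdmittance = -Γ.laplacian v Γ.a₀ := by
  have hpot : Γ.potential = v :=
    Γ.existsUnique_dirichletSolution.unique Γ.existsUnique_dirichletSolution.choose_spec.1 hv
  rw [effectiveAdmittance, laplacian, hpot, hv.2.2, ← finsum_neg_distrib]
  refine finsum_congr fun x => ?_
  rw [Γ.ρ_symm x, ← neg_mul, neg_sub]

theorem effectiveAdmittance_exhaustion [Infinite V] (n : ℕ+) {v : V → K}
    (hharm : ∀ x ∉ Γ.boundary, Γ.laplacian v x = 0) (hB : ∀ x ∈ Γ.B, v x = 0)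
    (hsphere : ∀ x ∈ Γ.sphere n, v x = 0) (ha₀ : v Γ.a₀ = 1) :
    (Γ.exhaustion n).effectiveAdmittance = -Γ.laplacian v Γ.a₀ := by
  have hsol : (Γ.exhaustion n).IsDirichletSolution (fun y => v y) := by
    refine ⟨fun x hx => ?_, fun x hx => hx.elim (hB x) (hsphere x), ha₀⟩
    rw [Γ.laplacian_exhaustion n v fun h => hx (Or.inl (Or.inr h)), hharm]
    rintro (h | h)
    · exact hx (Or.inl (Or.inl h))
    · exact hx (Or.inr (Subtype.ext h))
  have ha₀_notMem : Γ.a₀ ∉ Γ.sphere n := fun h =>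
    n.ne_zero ((SimpleGraph.dist_self.symm.trans h).symm)
  rw [hsol.effectiveAdmittance_eq_neg_laplacian,
    Γ.laplacian_exhaustion n v (x := (Γ.exhaustion n).a₀) ha₀_notMem]
  rfl

end Network

namespace LadderVertex

/-- The rail `a₀, x₁, x₂, …` of the ladder: `rail i` is `x_i`, with `a₀` in the role of `x₀`. -/
def rail : ℕ → LadderVertex
  | 0 => a 0
  | i + 1 => x i

/-- The distance from `a₀`, in closed form; it serves to bound the graph distance from below. -/
def depth : LadderVertex → ℕ
  | a 0 => 0
  | a (i + 1) => i + 2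
  | x i => i + 1

/-- The potential with value `u i` at `rail i` and `0` at the grounded vertices `a₁, a₂, …`. -/
def railPotential {K : Type*} [Zero K] (u : ℕ → K) : LadderVertex → K
  | a 0 => u 0
  | a (_ + 1) => 0
  | x i => u (i + 1)

theorem railPotential_rail {K : Type*} [Zero K] (u : ℕ → K) (i : ℕ) :
    railPotential u (rail i) = u i := by
  cases i <;> rfl

theorem adj_rail_zero_iff {v : LadderVertex} : graph.Adj (rail 0) v ↔ v = rail 1 := by
  rcases v with i | i <;> simp [graph, Adj, rail]

theorem adj_rail_succ_iff {i : ℕ} {v : LadderVertex} :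
    graph.Adj (rail (i + 1)) v ↔ v = rail i ∨ v = rail (i + 2) ∨ v = a (i + 1) := by
  rcases i with _ | i <;> rcases v with j | j <;> simp [graph, Adj, rail, eq_comm, or_comm]

theorem depth_le_succ_of_adj : ∀ v w, graph.Adj v w → depth w ≤ depth v + 1 := by
  rintro ((_ | i) | i) ((_ | j) | j) h <;> simp only [graph, Adj, depth] at h ⊢ <;> omega

theorem dist_rail (i : ℕ) : graph.dist (rail 0) (rail i) = i := by
  apply le_antisymm
  · induction i with
    | zero => exact SimpleGraph.dist_self.le
    | succ i ih =>
      have hadj : graph.Adj (rail (i + 1)) (rail i) := adj_rail_succ_iff.mpr (Or.inl rfl)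
      exact (dist_le_dist_add_one_of_adj hadj.symm).trans (Nat.succ_le_succ ih)
  · have hdepth (k : ℕ) : depth (rail k) = k := by cases k <;> rfl
    have hle := le_add_dist_of_adj_le graph_connected depth_le_succ_of_adj (rail 0) (rail i)
    rwa [hdepth, hdepth, zero_add] at hle

end LadderVertex

section Ladder

open LadderVertex

variable {K : Type*} [Field K] [LinearOrder K] {α β : K} (hα : 0 < α) (hβ : 0 < β)

theorem ladderNetwork_laplacian_rail_zero (u : ℕ → K) :
    (ladderNetwork α β hα hβ).laplacian (railPotential u) (rail 0) = α * (u 1 - u 0) := by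
  rw [(ladderNetwork α β hα hβ).laplacian_eq_sum _ (s := {rail 1})
    fun y hy => Finset.mem_singleton.mpr (adj_rail_zero_iff.mp hy)]
  simp [ladderNetwork, rail, railPotential, weight, mul_comm]

theorem ladderNetwork_laplacian_rail_succ (u : ℕ → K) (i : ℕ) :
    (ladderNetwork α β hα hβ).laplacian (railPotential u) (rail (i + 1)) =
      α * (u i - 2 * u (i + 1) + u (i + 2)) - β * u (i + 1) := by
  classical
  rw [(ladderNetwork α β hα hβ).laplacian_eq_sum _ (s := {rail i, rail (i + 2), a (i + 1)})
    fun y hy => by simpa using adj_rail_succ_iff.mp hy]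
  have hback : weight α β (rail (i + 1)) (rail i) = α := by cases i <;> simp [rail, weight]
  have hforward : weight α β (rail (i + 1)) (rail (i + 2)) = α := by simp [rail, weight]
  have hground : weight α β (rail (i + 1)) (a (i + 1)) = β := by simp [rail, weight]
  rw [Finset.sum_insert (by cases i <;> simp [rail]), Finset.sum_pair (by simp [rail])]
  change (railPotential u (rail i) - u (i + 1)) * weight α β (rail (i + 1)) (rail i) +
    ((u (i + 2) - u (i + 1)) * weight α β (rail (i + 1)) (rail (i + 2)) +
      (0 - u (i + 1)) * weight α β (rail (i + 1)) (a (i + 1))) = _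
  rw [hback, hforward, hground, railPotential_rail]
  ring

variable [IsStrictOrderedRing K]

theorem effectiveAdmittance_exhaustion_ladderNetwork (n : ℕ+) {u : ℕ → K} (hu0 : u 0 = 1)
    (hun : u n = 0)
    (hu : ∀ i, α * (u i - 2 * u (i + 1) + u (i + 2)) = β * u (i + 1)) :
    ((ladderNetwork α β hα hβ).exhaustion n).effectiveAdmittance = α * (1 - u 1) := by
  have hharm : ∀ y ∉ (ladderNetwork α β hα hβ).boundary,
      (ladderNetwork α β hα hβ).laplacian (railPotential u) y = 0 := by
    rintro ((_ | i) | i) hy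
    · exact absurd (Or.inr rfl) hy
    · exact absurd (Or.inl ⟨i, rfl⟩) hy
    · exact (ladderNetwork_laplacian_rail_succ hα hβ u i).trans (sub_eq_zero.mpr (hu i))
  have hB : ∀ y ∈ (ladderNetwork α β hα hβ).B, railPotential u y = 0 := by
    rintro _ ⟨i, rfl⟩
    rfl
  have hsphere : ∀ y ∈ (ladderNetwork α β hα hβ).sphere n, railPotential u y = 0 := by
    rintro ((_ | i) | i) hy
    · exact absurd ((dist_rail 0).symm.trans hy).symm n.ne_zero
    · rfl
    · exact (congrArg u ((dist_rail (i + 1)).symm.trans hy)).trans hun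
  rw [Network.effectiveAdmittance_exhaustion n hharm hB hsphere hu0]
  refine (congrArg Neg.neg (ladderNetwork_laplacian_rail_zero hα hβ u)).trans ?_
  rw [hu0, ← mul_neg, neg_sub]

/-- The potential along the rail of the `n`-th finite ladder: the combination of the geometric
sequences `ψ ^ i` and `ψ ^ (-i)` that is `1` at `0` and `0` at `n`. The index `i` is not bounded by
`2 * n`, hence `ψ ^ (2 * n) * (ψ ^ i)⁻¹` instead of a truncated difference of exponents. -/
def ladderSolution (ψ : K) (n i : ℕ) : K :=
  (ψ ^ (2 * n) * (ψ ^ i)⁻¹ - ψ ^ i) / (ψ ^ (2 * n) - 1)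

theorem effectiveAdmittance_exhaustion_ladderNetwork_of_root (n : ℕ+) {ψ : K} (hψ1 : 1 < ψ)
    (hψ : α * (ψ - 1) ^ 2 = β * ψ) :
    ((ladderNetwork α β hα hβ).exhaustion n).effectiveAdmittance =
      α * (1 - ψ⁻¹) + α * (ψ - ψ⁻¹) / (ψ ^ (2 * (n : ℕ)) - 1) := by
  have hψ0 : ψ ≠ 0 := (zero_lt_one.trans hψ1).ne'
  have hpow : ψ ^ (2 * (n : ℕ)) - 1 ≠ 0 :=
    (sub_pos.mpr (one_lt_pow₀ hψ1 (mul_ne_zero two_ne_zero n.ne_zero))).ne'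
  have hrec (i : ℕ) : α * (ladderSolution ψ n i - 2 * ladderSolution ψ n (i + 1) +
      ladderSolution ψ n (i + 2)) = β * ladderSolution ψ n (i + 1) := by
    rw [eq_div_of_mul_eq hψ0 hψ.symm]
    simp only [ladderSolution]
    field_simp
    ring
  have hstart : ladderSolution ψ n 0 = 1 := by simp [ladderSolution, hpow]
  have hend : ladderSolution ψ n n = 0 := by
    rw [ladderSolution, two_mul, pow_add, mul_inv_cancel_right₀ (pow_ne_zero _ hψ0), sub_self,
      zero_div]
  rw [effectiveAdmittance_exhaustion_ladderNetwork hα hβ n hstart hend hrec, ladderSolution]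
  field_simp
  ring

theorem effectiveAdmittance_exhaustion_ladderNetwork_sub {ξ : K} (hξ : 0 < ξ)
    (hsq : ξ ^ 2 = β / α + (β / (2 * α)) ^ 2) (n : ℕ+) :
    ((ladderNetwork α β hα hβ).exhaustion n).effectiveAdmittance - β / (β / (2 * α) + ξ) =
      2 * α * ξ / ((1 + β / (2 * α) + ξ) ^ (2 * (n : ℕ)) - 1) := by
  obtain ⟨b, hb⟩ : ∃ b, b = β / (2 * α) := ⟨_, rfl⟩
  have hb0 : 0 < b := hb ▸ by positivity
  have hβb : β = 2 * α * b := by rw [hb, mul_div_cancel₀ _ (by positivity)]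
  rw [← hb] at hsq ⊢
  have hsq' : ξ ^ 2 = 2 * b + b ^ 2 := by
    rw [hsq, hβb]
    field_simp
  have hroot : α * (1 + b + ξ - 1) ^ 2 = β * (1 + b + ξ) := by
    rw [hβb]
    linear_combination α * hsq'
  have hinv : (1 + b + ξ)⁻¹ = 1 + b - ξ :=
    inv_eq_of_mul_eq_one_right (by linear_combination -hsq')
  have hlimit : β / (b + ξ) = α * (ξ - b) := by
    rw [div_eq_iff (by positivity), hβb]
    linear_combination -α * hsq'
  rw [effectiveAdmittance_exhaustion_ladderNetwork_of_root hα hβ n (by linarith) hroot, hinv,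
    hlimit]
  ring

end Ladder

theorem exists_powerSeries_sq_eq {R : Type*} [CommRing R] {f : PowerSeries R} {c : R}
    (hf : PowerSeries.constantCoeff f = c ^ 2) (hc : IsUnit (2 * c)) :
    ∃ s : PowerSeries R, s ^ 2 = f ∧ PowerSeries.constantCoeff s = c := by
  let p : Polynomial (PowerSeries R) := Polynomial.X ^ 2 - Polynomial.C f
  have hmonic : p.Monic := Polynomial.monic_X_pow_sub_C f two_ne_zero
  have hp : p.eval (PowerSeries.C c) ∈ Ideal.span {(PowerSeries.X : PowerSeries R)} := by
    rw [Ideal.mem_span_singleton, PowerSeries.X_dvd_iff]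
    simp [p, hf]
  have hp' : IsUnit (p.derivative.eval (PowerSeries.C c)) := by
    have hderiv : p.derivative.eval (PowerSeries.C c) = PowerSeries.C (2 * c) := by
      simp [p, one_add_one_eq_two, map_ofNat]
    exact hderiv ▸ hc.map PowerSeries.C
  obtain ⟨s, hs, hsc⟩ := HenselianRing.is_henselian p hmonic _ hp (hp'.map (Ideal.Quotient.mk _))
  rw [Ideal.mem_span_singleton, PowerSeries.X_dvd_iff, map_sub, PowerSeries.constantCoeff_C,
    sub_eq_zero] at hsc
  exact ⟨s, by simpa [p, sub_eq_zero] using hs, hsc⟩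

theorem LeftFinite.range_natCast : LeftFinite (Set.range (Nat.cast : ℕ → ℚ)) := by
  intro r
  obtain ⟨N, hN⟩ := exists_nat_gt r
  refine ((Set.finite_Iio N).image (Nat.cast : ℕ → ℚ)).subset ?_
  rintro _ ⟨⟨k, rfl⟩, hk⟩
  exact ⟨k, Nat.cast_lt.mp (lt_trans hk hN), rfl⟩

namespace LeviCivita

theorem support_ofPowerSeries_subset (f : PowerSeries ℝ) :
    (HahnSeries.ofPowerSeries ℚ ℝ f).support ⊆ Set.range (Nat.cast : ℕ → ℚ) := by
  rw [HahnSeries.ofPowerSeries_apply]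
  exact HahnSeries.support_embDomain_subset.trans (Set.image_subset_range _ _)

/-- The embedding of real power series into the Levi-Civita field that sends the variable
to `τ`. -/
noncomputable def ofPowerSeries : PowerSeries ℝ →+* LeviCivita where
  toFun f := ⟨toLex (HahnSeries.ofPowerSeries ℚ ℝ f),
    LeftFinite.range_natCast.mono (support_ofPowerSeries_subset f)⟩
  map_one' := Subtype.ext (congrArg toLex (map_one (HahnSeries.ofPowerSeries ℚ ℝ)))
  map_zero' := Subtype.ext (congrArg toLex (map_zero (HahnSeries.ofPowerSeries ℚ ℝ)))
  map_mul' f g := Subtype.ext (congrArg toLex (map_mul (HahnSeries.ofPowerSeries ℚ ℝ) f g))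
  map_add' f g := Subtype.ext (congrArg toLex (map_add (HahnSeries.ofPowerSeries ℚ ℝ) f g))

theorem ofPowerSeries_C (c : ℝ) : ofPowerSeries (PowerSeries.C c) = ofReal c :=
  Subtype.ext (congrArg toLex (HahnSeries.ofPowerSeries_C (Γ := ℚ) c))

theorem ofPowerSeries_X : ofPowerSeries PowerSeries.X = τ :=
  Subtype.ext (congrArg toLex (HahnSeries.ofPowerSeries_X (Γ := ℚ) (R := ℝ)))

theorem coeff_ofPowerSeries_natCast (f : PowerSeries ℝ) (n : ℕ) :
    (ofPowerSeries f).coeff n = PowerSeries.coeff n f :=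
  HahnSeries.ofPowerSeries_apply_coeff f n

theorem exists_natCast_eq_of_coeff_ofPowerSeries_ne_zero {f : PowerSeries ℝ} {q : ℚ}
    (h : (ofPowerSeries f).coeff q ≠ 0) : ∃ k : ℕ, (k : ℚ) = q :=
  support_ofPowerSeries_subset f h

theorem coeff_ofPowerSeries_of_neg (f : PowerSeries ℝ) {q : ℚ} (hq : q < 0) :
    (ofPowerSeries f).coeff q = 0 := by
  by_contra h
  obtain ⟨k, rfl⟩ := exists_natCast_eq_of_coeff_ofPowerSeries_ne_zero h
  exact hq.not_ge k.cast_nonneg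

theorem coeff_zero (q : ℚ) : coeff 0 q = 0 := rfl

theorem coeff_neg (x : LeviCivita) (q : ℚ) : (-x).coeff q = -x.coeff q := rfl

theorem coeff_τ_mul (x : LeviCivita) (q : ℚ) : (τ * x).coeff q = x.coeff (q - 1) :=
  HahnSeries.coeff_single_mul.trans (one_mul _)

theorem coeff_τ_zpow_mul (m : ℤ) (x : LeviCivita) (q : ℚ) :
    (τ ^ m * x).coeff q = x.coeff (q - m) := by
  have hτ : τ ≠ 0 := τ_pos.ne'
  induction m using Int.induction_on generalizing x with
  | zero => simp
  | succ m ih =>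
    rw [zpow_add_one₀ hτ, mul_assoc, ih, coeff_τ_mul]
    push_cast
    ring_nf
  | pred m ih =>
    have hshift : (τ⁻¹ * x).coeff (q + m) = x.coeff (q + m + 1) := by
      have h := coeff_τ_mul (τ⁻¹ * x) (q + m + 1)
      rwa [mul_inv_cancel_left₀ hτ, add_sub_cancel_right, eq_comm] at h
    rw [zpow_sub_one₀ hτ, mul_assoc, ih]
    push_cast
    rw [sub_neg_eq_add, hshift]
    ring_nf

theorem lt_iff_coeff {x y : LeviCivita} :
    x < y ↔ ∃ q, (∀ r < q, x.coeff r = y.coeff r) ∧ x.coeff q < y.coeff q :=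
  HahnSeries.lt_iff _ _

theorem ofPowerSeries_pos {f : PowerSeries ℝ} (hf : 0 < PowerSeries.constantCoeff f) :
    0 < ofPowerSeries f := by
  refine lt_iff_coeff.mpr ⟨0, fun r hr => ?_, ?_⟩
  · rw [coeff_ofPowerSeries_of_neg f hr, coeff_zero]
  · have h := coeff_ofPowerSeries_natCast f 0
    rw [Nat.cast_zero, PowerSeries.coeff_zero_eq_constantCoeff_apply] at h
    rwa [coeff_zero, h]

theorem ofPowerSeries_inv {f : PowerSeries ℝ} (hf : PowerSeries.constantCoeff f ≠ 0) :
    ofPowerSeries f⁻¹ = (ofPowerSeries f)⁻¹ :=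
  eq_inv_of_mul_eq_one_right (by rw [← map_mul, PowerSeries.mul_inv_cancel f hf, map_one])

theorem abs_lt_of_coeff_eq_zero {x ε : LeviCivita} {m : ℚ} (hx : ∀ q ≤ m, x.coeff q = 0)
    (hε0 : 0 < ε) (hε : ε.coeff m ≠ 0) : |x| < ε := by
  obtain ⟨q, hlt, hq⟩ := lt_iff_coeff.mp hε0
  have hqm : q ≤ m := not_lt.mp fun h => hε (hlt m h).symm
  rw [abs_eq_max_neg, max_lt_iff, lt_iff_coeff, lt_iff_coeff]
  refine ⟨⟨q, fun r hr => ?_, ?_⟩, ⟨q, fun r hr => ?_, ?_⟩⟩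
  · rw [hx r (hr.le.trans hqm), ← hlt r hr, coeff_zero]
  · rwa [hx q hqm]
  · rw [coeff_neg, hx r (hr.le.trans hqm), ← hlt r hr, coeff_zero, neg_zero]
  · rwa [coeff_neg, hx q hqm, neg_zero]

/-- `x = c τ ^ m + o(τ ^ m)`, expressed by a factorization `x = τ ^ m * f(τ)` with a power series
`f` of constant coefficient `c`. The case `c = 0` is allowed and means `x = o(τ ^ m)`. -/
def HasLeadingTerm (x : LeviCivita) (m : ℤ) (c : ℝ) : Prop :=
  ∃ f : PowerSeries ℝ, PowerSeries.constantCoeff f = c ∧ x = τ ^ m * ofPowerSeries f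

theorem hasLeadingTerm_ofPowerSeries (f : PowerSeries ℝ) :
    HasLeadingTerm (ofPowerSeries f) 0 (PowerSeries.constantCoeff f) :=
  ⟨f, rfl, by rw [zpow_zero, one_mul]⟩

theorem hasLeadingTerm_ofReal (c : ℝ) : HasLeadingTerm (ofReal c) 0 c := by
  simpa [ofPowerSeries_C] using hasLeadingTerm_ofPowerSeries (PowerSeries.C c)

theorem hasLeadingTerm_intCast (k : ℤ) : HasLeadingTerm k 0 k := by
  simpa using hasLeadingTerm_ofPowerSeries (k : PowerSeries ℝ)

theorem hasLeadingTerm_τ : HasLeadingTerm τ 1 1 :=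
  ⟨1, map_one _, by rw [map_one, mul_one, zpow_one]⟩

namespace HasLeadingTerm

variable {x y : LeviCivita} {m k : ℤ} {c d : ℝ}

theorem mul (hx : HasLeadingTerm x m c) (hy : HasLeadingTerm y k d) :
    HasLeadingTerm (x * y) (m + k) (c * d) := by
  obtain ⟨f, rfl, rfl⟩ := hx
  obtain ⟨g, rfl, rfl⟩ := hy
  exact ⟨f * g, map_mul _ f g, by rw [map_mul, zpow_add₀ τ_pos.ne', mul_mul_mul_comm]⟩

theorem pow (hx : HasLeadingTerm x m c) (n : ℕ) : HasLeadingTerm (x ^ n) (n * m) (c ^ n) := by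
  obtain ⟨f, rfl, rfl⟩ := hx
  exact ⟨f ^ n, map_pow _ f n, by rw [map_pow, mul_pow, ← zpow_natCast, ← zpow_mul, mul_comm m]⟩

theorem inv (hx : HasLeadingTerm x m c) (hc : c ≠ 0) : HasLeadingTerm x⁻¹ (-m) c⁻¹ := by
  obtain ⟨f, rfl, rfl⟩ := hx
  exact ⟨f⁻¹, PowerSeries.constantCoeff_inv f, by rw [ofPowerSeries_inv hc, mul_inv, zpow_neg]⟩

theorem div (hx : HasLeadingTerm x m c) (hy : HasLeadingTerm y k d) (hd : d ≠ 0) :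
    HasLeadingTerm (x / y) (m - k) (c / d) := by
  simpa only [div_eq_mul_inv, sub_eq_add_neg] using hx.mul (hy.inv hd)

theorem add (hx : HasLeadingTerm x m c) (hy : HasLeadingTerm y m d) :
    HasLeadingTerm (x + y) m (c + d) := by
  obtain ⟨f, rfl, rfl⟩ := hx
  obtain ⟨g, rfl, rfl⟩ := hy
  exact ⟨f + g, map_add _ f g, by rw [map_add, mul_add]⟩

theorem of_lt (hx : HasLeadingTerm x m c) (hkm : k < m) : HasLeadingTerm x k 0 := by
  obtain ⟨f, rfl, rfl⟩ := hx
  obtain ⟨j, rfl⟩ := Int.exists_add_of_le (Int.add_one_le_iff.mpr hkm)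
  refine ⟨PowerSeries.X ^ (j + 1) * f, by simp, ?_⟩
  rw [map_mul, map_pow, ofPowerSeries_X, ← mul_assoc, ← zpow_natCast, ← zpow_add₀ τ_pos.ne']
  push_cast
  ring_nf

theorem add_of_lt (hx : HasLeadingTerm x m c) (hy : HasLeadingTerm y k d) (hmk : m < k) :
    HasLeadingTerm (x + y) m c := by
  simpa only [add_zero] using hx.add (hy.of_lt hmk)

theorem pos (hx : HasLeadingTerm x m c) (hc : 0 < c) : 0 < x := by
  obtain ⟨f, rfl, rfl⟩ := hx
  exact mul_pos (zpow_pos τ_pos m) (ofPowerSeries_pos hc)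

theorem exists_sq_eq (hx : HasLeadingTerm x (2 * m) (c ^ 2)) (hc : c ≠ 0) :
    ∃ y, HasLeadingTerm y m c ∧ y ^ 2 = x := by
  obtain ⟨f, hf, rfl⟩ := hx
  obtain ⟨s, rfl, hs⟩ := exists_powerSeries_sq_eq hf (mul_ne_zero two_ne_zero hc).isUnit
  refine ⟨τ ^ m * ofPowerSeries s, ⟨s, hs, rfl⟩, ?_⟩
  rw [mul_pow, map_pow, ← zpow_natCast (τ ^ m), ← zpow_mul, mul_comm m, Nat.cast_ofNat]

theorem existsUnique_pos_sq_eq (hx : HasLeadingTerm x (2 * m) (c ^ 2)) (hc : 0 < c) :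
    ∃! y, 0 < y ∧ y ^ 2 = x := by
  obtain ⟨y, hy, hyx⟩ := hx.exists_sq_eq hc.ne'
  refine ⟨y, ⟨hy.pos hc, hyx⟩, fun z ⟨hz, hzx⟩ => ?_⟩
  exact (pow_left_inj₀ hz.le (hy.pos hc).le two_ne_zero).mp (hzx.trans hyx.symm)

theorem of_sq (hx : HasLeadingTerm (x ^ 2) (2 * m) (c ^ 2)) (hc : 0 < c) (hx0 : 0 < x) :
    HasLeadingTerm x m c := by
  obtain ⟨y, hy, hyx⟩ := hx.exists_sq_eq hc.ne'
  rwa [← (pow_left_inj₀ (hy.pos hc).le hx0.le two_ne_zero).mp hyx]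

theorem isLittleOTau (hx : HasLeadingTerm x m 0) : x.IsLittleOTau m := by
  obtain ⟨f, hf, rfl⟩ := hx
  obtain ⟨g, rfl⟩ := PowerSeries.X_dvd_iff.mpr hf
  intro q hq
  rw [map_mul, ofPowerSeries_X, ← mul_assoc, ← zpow_add_one₀ τ_pos.ne', coeff_τ_zpow_mul] at hq
  obtain ⟨j, hj⟩ := exists_natCast_eq_of_coeff_ofPowerSeries_ne_zero hq
  refine ⟨m + 1 + j, by omega, ?_⟩
  push_cast at hj ⊢
  linarith

theorem exists_isLittleOTau (hx : HasLeadingTerm x m c) :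
    ∃ r : LeviCivita, r.IsLittleOTau m ∧ x = ofReal c * τ ^ m + r := by
  obtain ⟨f, rfl, rfl⟩ := hx
  refine ⟨τ ^ m * ofPowerSeries (f - PowerSeries.C (PowerSeries.constantCoeff f)),
    isLittleOTau ⟨_, by simp, rfl⟩, ?_⟩
  rw [map_sub, ofPowerSeries_C]
  ring

theorem tendsto_zero {ι : Type*} {l : Filter ι} {x : ι → LeviCivita} {m : ι → ℤ} {c : ι → ℝ}
    (hx : ∀ i, HasLeadingTerm (x i) (m i) (c i)) (hm : Tendsto m l atTop) :
    Tendsto x l (𝓝 0) := by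
  rw [LinearOrderedAddCommGroup.tendsto_nhds]
  intro ε hε
  obtain ⟨q, -, hq⟩ := lt_iff_coeff.mp hε
  filter_upwards [hm.eventually_gt_atTop ⌈q⌉] with i hi
  obtain ⟨f, -, hf⟩ := hx i
  rw [sub_zero, hf]
  refine abs_lt_of_coeff_eq_zero (m := q) (fun r hr => ?_) hε hq.ne'
  rw [coeff_τ_zpow_mul]
  have hqm : q < m i := (Int.le_ceil q).trans_lt (Int.cast_lt.mpr hi)
  exact coeff_ofPowerSeries_of_neg _ (by linarith)

end HasLeadingTerm

theorem hasLeadingTerm_coilAdmittance (L : ℝ) : HasLeadingTerm (coilAdmittance L) 1 L⁻¹ := by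
  simpa [coilAdmittance] using (hasLeadingTerm_ofReal L⁻¹).mul hasLeadingTerm_τ

theorem hasLeadingTerm_capacitorAdmittance (C : ℝ) :
    HasLeadingTerm (capacitorAdmittance C) (-1) C := by
  simpa [capacitorAdmittance] using
    (hasLeadingTerm_ofReal C).mul (hasLeadingTerm_τ.inv one_ne_zero)

section LadderExpansion

variable {α β ξ : LeviCivita} {j k : ℤ} {l c : ℝ}

theorem hasLeadingTerm_two_mul (hα : HasLeadingTerm α j l) : HasLeadingTerm (2 * α) j (2 * l) := by
  simpa using (hasLeadingTerm_intCast 2).mul hα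

theorem hasLeadingTerm_ladderDiscriminant (hl : l ≠ 0) (hkj : k < j) (hα : HasLeadingTerm α j l)
    (hβ : HasLeadingTerm β k c) :
    HasLeadingTerm (β / α + (β / (2 * α)) ^ 2) (2 * (k - j)) ((c / (2 * l)) ^ 2) := by
  rw [add_comm]
  have hsq := (hβ.div (hasLeadingTerm_two_mul hα) (mul_ne_zero two_ne_zero hl)).pow 2
  exact hsq.add_of_lt (hβ.div hα hl) (by push_cast; omega)

theorem hasLeadingTerm_ladderRoot (hl : l ≠ 0) (hkj : k < j) (hα : HasLeadingTerm α j l)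
    (hβ : HasLeadingTerm β k c) (hξ : HasLeadingTerm ξ (k - j) (c / (2 * l))) :
    HasLeadingTerm (1 + β / (2 * α) + ξ) (k - j) (c / l) := by
  have hsum := (hβ.div (hasLeadingTerm_two_mul hα) (mul_ne_zero two_ne_zero hl)).add hξ
  have hone : HasLeadingTerm 1 0 1 := by simpa using hasLeadingTerm_intCast 1
  convert hsum.add_of_lt hone (by omega) using 1
  · ring
  · field_simp
    ring

theorem hasLeadingTerm_ladderError (hl : 0 < l) (hc : 0 < c) (hkj : k < j)
    (hα : HasLeadingTerm α j l) (hβ : HasLeadingTerm β k c)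
    (hξ : HasLeadingTerm ξ (k - j) (c / (2 * l))) {n : ℕ} (hn : 0 < n) :
    HasLeadingTerm (2 * α * ξ / ((1 + β / (2 * α) + ξ) ^ (2 * n) - 1))
      (k + 2 * n * (j - k)) (c / (c / l) ^ (2 * n)) := by
  have hnum : HasLeadingTerm (2 * α * ξ) k c := by
    convert (hasLeadingTerm_two_mul hα).mul hξ using 1
    · ring
    · field_simp
  have hden : HasLeadingTerm ((1 + β / (2 * α) + ξ) ^ (2 * n) - 1) (2 * n * (k - j))
      ((c / l) ^ (2 * n)) := by
    have hpow := (hasLeadingTerm_ladderRoot hl.ne' hkj hα hβ hξ).pow (2 * n)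
    have hneg_one : HasLeadingTerm (-1) 0 (-1) := by simpa using hasLeadingTerm_intCast (-1)
    push_cast at hpow
    rw [sub_eq_add_neg]
    exact hpow.add_of_lt hneg_one (mul_neg_of_pos_of_neg (by omega) (by omega))
  convert hnum.div hden (by positivity) using 1
  ring

end LadderExpansion

end LeviCivita

open LeviCivita in
theorem mainTheorem9_general {α β : LeviCivita} {j k : ℤ} {l c : ℝ} (hl : 0 < l) (hc : 0 < c)
    (hkj : k < j) (hα : HasLeadingTerm α j l) (hβ : HasLeadingTerm β k c) :
    (∃! ξ : LeviCivita, 0 < ξ ∧ ξ ^ 2 = β / α + (β / (2 * α)) ^ 2) ∧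
    ∀ ξ : LeviCivita, 0 < ξ → ξ ^ 2 = β / α + (β / (2 * α)) ^ 2 →
      Tendsto (fun n : ℕ+ =>
          ((ladderNetwork α β (hα.pos hl) (hβ.pos hc)).exhaustion n).effectiveAdmittance)
        atTop (𝓝 (β / (β / (2 * α) + ξ))) ∧
      ∀ n : ℕ+,
        ((ladderNetwork α β (hα.pos hl) (hβ.pos hc)).exhaustion n).effectiveAdmittance -
            β / (β / (2 * α) + ξ) = 2 * α * ξ / ((1 + β / (2 * α) + ξ) ^ (2 * (n : ℕ)) - 1) ∧
        ∃ r : LeviCivita, r.IsLittleOTau (k + 2 * (n : ℕ) * (j - k)) ∧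
          2 * α * ξ / ((1 + β / (2 * α) + ξ) ^ (2 * (n : ℕ)) - 1) =
            ofReal (c / (c / l) ^ (2 * (n : ℕ))) * τ ^ (k + 2 * (n : ℕ) * (j - k)) + r := by
  have hdisc := hasLeadingTerm_ladderDiscriminant hl.ne' hkj hα hβ
  have hcoeff : 0 < c / (2 * l) := by positivity
  refine ⟨hdisc.existsUnique_pos_sq_eq hcoeff, fun ξ hξ0 hξsq => ?_⟩
  have hξ : HasLeadingTerm ξ (k - j) (c / (2 * l)) := .of_sq (hξsq ▸ hdisc) hcoeff hξ0
  have herror (n : ℕ+) := effectiveAdmittance_exhaustion_ladderNetwork_sub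
    (hα.pos hl) (hβ.pos hc) hξ0 hξsq n
  have hexpansion (n : ℕ+) := hasLeadingTerm_ladderError hl hc hkj hα hβ hξ n.pos
  have hexponent : Tendsto (fun n : ℕ+ => k + 2 * (n : ℕ) * (j - k)) atTop atTop :=
    tendsto_atTop_add_const_left _ _ <| Tendsto.atTop_mul_const' (sub_pos.mpr hkj) <|
      Tendsto.const_mul_atTop' two_pos <|
        tendsto_natCast_atTop_atTop.comp tendsto_PNat_val_atTop_atTop
  refine ⟨tendsto_sub_nhds_zero_iff.mp ?_, fun n => ⟨herror n, (hexpansion n).exists_isLittleOTau⟩⟩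
  exact HasLeadingTerm.tendsto_zero (fun n => herror n ▸ hexpansion n) hexponent

theorem mainTheorem9 (L C : ℝ) (hL : 0 < L) (hC : 0 < C) (α β : LeviCivita)
    (hα : α = coilAdmittance L) (hβ : β = capacitorAdmittance C) :
    (∃! ξ : LeviCivita, 0 < ξ ∧ ξ ^ 2 = β / α + (β / (2 * α)) ^ 2) ∧
    ∀ ξ : LeviCivita, 0 < ξ → ξ ^ 2 = β / α + (β / (2 * α)) ^ 2 →
      Tendsto (fun n : ℕ+ => ((feynmanLadder L C hL hC).exhaustion n).effectiveAdmittance)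
        atTop (𝓝 (β / (β / (2 * α) + ξ))) ∧
      ∀ n : ℕ+,
        ((feynmanLadder L C hL hC).exhaustion n).effectiveAdmittance - β / (β / (2 * α) + ξ) =
            2 * α * ξ / ((1 + β / (2 * α) + ξ) ^ (2 * (n : ℕ)) - 1) ∧
        ∃ r : LeviCivita, r.IsLittleOTau (4 * (n : ℤ) - 1) ∧
          2 * α * ξ / ((1 + β / (2 * α) + ξ) ^ (2 * (n : ℕ)) - 1) =
            LeviCivita.ofReal (C / (C * L) ^ (2 * (n : ℕ))) * LeviCivita.τ ^ (4 * (n : ℤ) - 1)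
              + r := by
  subst hα hβ
  have hmain := mainTheorem9_general (inv_pos.mpr hL) hC (by norm_num)
    (LeviCivita.hasLeadingTerm_coilAdmittance L) (LeviCivita.hasLeadingTerm_capacitorAdmittance C)
  have hexponent (n : ℕ) : (-1 : ℤ) + 2 * n * (1 - -1) = 4 * n - 1 := by ring
  simpa only [hexponent, div_inv_eq_mul, feynmanLadder] using hmain
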